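/- For $n\ge 1$ let $W=(W_{i,j})_{1\le i,j\le n}$ be a random symmetric matrix with zero diagonal such that the entries $W_{i,j}$, $1\le i<j\le n$, are independent standard normal random variables. For a spin configuration $\sigma\in\{-1,1\}^n$ put $$H(\sigma)=\sum_{1\le i<j\le n}\sigma_i\sigma_jW_{i,j},$$ and for $i\in\{1,\dots,n\}$ let $\sigma^{(i)}$ be the configuration obtained from $\sigma$ by changing the sign of the $i$-th coordinate. Call $\sigma$ locally optimal if $H(\sigma^{(i)})\ge H(\sigma)$ for every $i\in\{1,\dots,n\}$. Then there is an absolute constant $C$ such that for every $n\ge 1$ and every $\sigma\in\{-1,1\}^n$ the probability $\mathbb{P}\{\sigma\text{ is locally optimal}\}$ is positive and $$\frac{1}{2\pi}-\log 2-\frac{C}{n}\;\le\;\frac1n\log\mathbb{P}\{\sigma\text{ is locally optimal}\}\;\le\;\frac{2}{3\pi}-\log 2+\frac{C}{n}.$$ -/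

import Mathlib

open MeasureTheory ProbabilityTheory

noncomputable section

namespace SK

/-- Spin configurations in `{-1, +1}^n`; the two spins are the units `1` and `-1` of `ℤ`. -/
abbrev Config (n : ℕ) : Type := Fin n → ℤˣ

/-- The real value, `-1` or `+1`, of the `i`-th spin. -/
def spin {n : ℕ} (σ : Config n) (i : Fin n) : ℝ := ((σ i : ℤ) : ℝ)

/-- The Hamiltonian `H(σ) = ∑_{i < j} σ_i σ_j W_{ij}`. -/
def hamiltonian {n : ℕ} (W : Matrix (Fin n) (Fin n) ℝ) (σ : Config n) : ℝ :=
  ∑ i, ∑ j ∈ Finset.Ioi i, spin σ i * spin σ j * W i j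

/-- The configuration `σ^{(i)}` obtained from `σ` by flipping the `i`-th spin. -/
def flip {n : ℕ} (σ : Config n) (i : Fin n) : Config n := Function.update σ i (-σ i)

/-- `σ` is a local minimum of `H`: flipping a single spin does not decrease the energy. -/
def IsLocallyOptimal {n : ℕ} (W : Matrix (Fin n) (Fin n) ℝ) (σ : Config n) : Prop :=
  ∀ i, hamiltonian W σ ≤ hamiltonian W (flip σ i)

/-- `W` is a random symmetric matrix with zero diagonal whose entries above the diagonal are
independent standard normal random variables. -/
structure IsDisorder {n : ℕ} {Ω : Type*} [MeasurableSpace Ω] (μ : Measure Ω)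
    (W : Ω → Matrix (Fin n) (Fin n) ℝ) : Prop where
  symm : ∀ ω, (W ω).IsSymm
  diag : ∀ ω i, W ω i i = 0
  law : ∀ i j : Fin n, i < j → HasLaw (fun ω => W ω i j) (gaussianReal 0 1) μ
  indep : iIndepFun (fun (p : {p : Fin n × Fin n // p.1 < p.2}) ω => W ω p.1.1 p.1.2) μ

end SK

end

namespace SK

/-! ### Linear images of standard Gaussian vectors -/

/-! Flipping spin i changes H by twice a local field, and the local fields are jointly centred
Gaussian. Each has variance n - 1, and two of them share exactly one coupling, so the covariance
matrix is (n - 2)I plus the all-ones matrix. With c = √(n - 2), this is also the covariance of (X -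
cY_i)_i for independent standard normals X, Y_1, …, Y_n (`map_localField`). Conditioning on X, the
probability is E Φ(X/c)^n when c > 0.

Lower bound: restrict to X just above c/2 and all Y_i ≤ 1/2. This costs about c²/8 in the exponent,
while 2Φ(1/2) ≥ e^0.3, and 0.3 - 1/8 exceeds 1/(2π). Upper bound: 2Φ(y) ≤ 1.087 e^(y/2)
(`two_mul_cdf_le`) reduces the expectation to a Gaussian moment generating function; the rate is at
most 0.087 + 1/8 = 0.212 < 2/(3π). The level 1/2 is close to the maximiser of log Φ(y) - y²/2, which
is why it serves in both directions. -/

lemma charFunDual_gaussianReal (L : StrongDual ℝ ℝ) :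
    charFunDual (gaussianReal 0 1) L = Complex.exp (-((L 1 ^ 2 : ℝ) : ℂ) / 2) := by
  rw [IsGaussian.charFunDual_eq]
  have h : ∫ x, L x ∂gaussianReal 0 1 = 0 := by
    rw [integral_continuousLinearMap_gaussianReal, map_zero]
  rw [integral_complex_ofReal, h, variance_continuousLinearMap_gaussianReal]
  congr 1
  simp [max_eq_left (sq_nonneg (L 1)), neg_div]

lemma charFunDual_pi_gaussianReal {ι : Type*} [Fintype ι] [DecidableEq ι]
    (L : StrongDual ℝ (ι → ℝ)) :
    charFunDual (Measure.pi fun _ : ι => gaussianReal 0 1) L =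
      Complex.exp (-((∑ i, L (Pi.single i 1) ^ 2 : ℝ) : ℂ) / 2) := by
  rw [charFunDual_pi]
  simp_rw [charFunDual_gaussianReal]
  rw [← Complex.exp_sum]
  congr 1
  push_cast
  rw [← Finset.sum_div, Finset.sum_neg_distrib]
  rfl

/-- For pairs `i < j`, the linear map `w ↦ (-∑_{j ≠ i} σ_i σ_j w_{ij})_i`. -/
noncomputable def localField {n : ℕ} (σ : Config n) :
    ({p : Fin n × Fin n // p.1 < p.2} → ℝ) →L[ℝ] (Fin n → ℝ) :=
  ∑ p, (ContinuousLinearMap.proj (R := ℝ) p).smulRight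
    (-(spin σ p.1.1 * spin σ p.1.2) •
      (Pi.single p.1.1 1 + Pi.single p.1.2 1 : Fin n → ℝ))

/-- The linear map `(x, y) ↦ (x - c y_i)_i`. -/
noncomputable def commonShift (n : ℕ) (c : ℝ) : (ℝ × (Fin n → ℝ)) →L[ℝ] (Fin n → ℝ) :=
  ContinuousLinearMap.pi fun i => ContinuousLinearMap.fst ℝ ℝ (Fin n → ℝ) -
    c • (ContinuousLinearMap.proj i).comp (ContinuousLinearMap.snd ℝ ℝ (Fin n → ℝ))

lemma spin_sq {n : ℕ} (σ : Config n) (i : Fin n) : spin σ i ^ 2 = 1 := by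
  rcases Int.units_eq_one_or (σ i) with h | h <;> simp [spin, h]

lemma sum_sum_Ioi_eq_sum_subtype {n : ℕ} (f : Fin n → Fin n → ℝ) :
    ∑ i, ∑ j ∈ Finset.Ioi i, f i j =
      ∑ p : {p : Fin n × Fin n // p.1 < p.2}, f p.1.1 p.1.2 := by
  rw [← Finset.sum_subtype (Finset.univ.filter fun p : Fin n × Fin n => p.1 < p.2) (by simp)
    (fun p => f p.1 p.2), Finset.sum_filter, Fintype.sum_prod_type]
  refine Finset.sum_congr rfl fun i _ => ?_
  rw [← Finset.sum_filter]
  exact Finset.sum_congr (by ext; simp) fun _ _ => rfl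

/-- Sum over all ordered pairs, remove the diagonal and halve. This is the quadratic form of the
covariance (n - 2)I plus the all-ones matrix. -/
lemma sum_pairs_sq_add {n : ℕ} (t : Fin n → ℝ) :
    ∑ p : {p : Fin n × Fin n // p.1 < p.2}, (t p.1.1 + t p.1.2) ^ 2 =
      (n - 2) * ∑ i, t i ^ 2 + (∑ i, t i) ^ 2 := by
  rw [← sum_sum_Ioi_eq_sum_subtype (fun i j => (t i + t j) ^ 2)]
  have hsplit : ∀ i, ∑ j, (t i + t j) ^ 2 = ∑ j ∈ Finset.Ioi i, (t i + t j) ^ 2 +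
      ∑ j ∈ Finset.Iio i, (t i + t j) ^ 2 + 4 * t i ^ 2 := by
    intro i
    have h1 : ∀ j, (t i + t j) ^ 2 = (if i < j then (t i + t j) ^ 2 else 0) +
        (if j < i then (t i + t j) ^ 2 else 0) + (if j = i then 4 * t i ^ 2 else 0) := by
      intro j
      rcases lt_trichotomy i j with h | h | h
      · simp [h, h.not_gt, h.ne']
      · subst h; simp; ring
      · simp [h, h.not_gt, h.ne]
    rw [Finset.sum_congr rfl fun j _ => h1 j, Finset.sum_add_distrib, Finset.sum_add_distrib,
      ← Finset.sum_filter, ← Finset.sum_filter, Finset.sum_ite_eq' Finset.univ i]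
    simp only [Finset.mem_univ, if_true]
    congr 2
    · exact Finset.sum_congr (by ext; simp) fun _ _ => rfl
    · exact Finset.sum_congr (by ext; simp) fun _ _ => rfl
  have hsymm : ∑ i, ∑ j ∈ Finset.Iio i, (t i + t j) ^ 2 =
      ∑ i, ∑ j ∈ Finset.Ioi i, (t i + t j) ^ 2 := by
    rw [Finset.sum_comm' (s := Finset.univ) (t := fun i => Finset.Iio i)
      (t' := Finset.univ) (s' := fun j => Finset.Ioi j) (by simp)]
    exact Finset.sum_congr rfl fun _ _ => Finset.sum_congr rfl fun _ _ => by ring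
  have htot : ∑ i, ∑ j, (t i + t j) ^ 2 = 2 * n * ∑ i, t i ^ 2 + 2 * (∑ i, t i) ^ 2 := by
    have h2 : ∀ i, ∑ j, (t i + t j) ^ 2 =
        n * t i ^ 2 + 2 * t i * ∑ j, t j + ∑ j, t j ^ 2 := by
      intro i
      simp_rw [add_sq, Finset.sum_add_distrib, ← Finset.mul_sum]
      simp
    simp_rw [h2, Finset.sum_add_distrib, ← Finset.mul_sum, ← Finset.sum_mul]
    rw [← Finset.mul_sum]
    simp
    ring
  rw [Finset.sum_congr rfl fun i _ => hsplit i, Finset.sum_add_distrib, Finset.sum_add_distrib,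
    hsymm, ← Finset.mul_sum] at htot
  linarith

lemma dual_apply_pi {n : ℕ} (L : StrongDual ℝ (Fin n → ℝ)) (v : Fin n → ℝ) :
    L v = ∑ i, v i * L (Pi.single i 1) := by
  conv_lhs => rw [← Finset.univ_sum_single v]
  rw [map_sum]
  refine Finset.sum_congr rfl fun i _ => ?_
  rw [← smul_eq_mul, ← map_smul, ← Pi.single_smul, smul_eq_mul, mul_one]

/-- Both sides are centred Gaussian, so comparing characteristic functions reduces to comparing the
variances of every linear functional. The signs disappear because spins square to 1. -/
lemma map_localField {n : ℕ} (hn : 2 ≤ n) (σ : Config n) :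
    (Measure.pi fun _ => gaussianReal 0 1).map (localField σ) =
      ((gaussianReal 0 1).prod (Measure.pi fun _ => gaussianReal 0 1)).map
        (commonShift n (Real.sqrt (n - 2))) := by
  have hn0 : (0 : ℝ) ≤ n - 2 := by
    have : (2 : ℝ) ≤ n := by exact_mod_cast hn
    linarith
  refine Measure.ext_of_charFunDual (funext fun L => ?_)
  rw [charFunDual_map, charFunDual_map, charFunDual_prod, charFunDual_pi_gaussianReal,
    charFunDual_gaussianReal, charFunDual_pi_gaussianReal, ← Complex.exp_add]
  congr 1
  have h1 : ∑ p, (L.comp (localField σ)) (Pi.single p 1) ^ 2 =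
      ∑ p : {p : Fin n × Fin n // p.1 < p.2},
        (L (Pi.single p.1.1 1) + L (Pi.single p.1.2 1)) ^ 2 := by
    refine Finset.sum_congr rfl fun p _ => ?_
    have : localField σ (Pi.single p 1) = -(spin σ p.1.1 * spin σ p.1.2) •
      (Pi.single p.1.1 1 + Pi.single p.1.2 1 : Fin n → ℝ) := by
      simp only [localField, _root_.sum_apply, ContinuousLinearMap.smulRight_apply,
        ContinuousLinearMap.proj_apply]
      rw [Finset.sum_eq_single p (fun q _ hq => by simp [hq]) (by simp)]
      simp
    rw [ContinuousLinearMap.comp_apply, this, map_smul, map_add, smul_eq_mul, mul_pow, neg_sq,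
      mul_pow, spin_sq, spin_sq]
    ring
  have h2 : ((L.comp (commonShift n (Real.sqrt (n - 2)))).comp
      (ContinuousLinearMap.inl ℝ ℝ (Fin n → ℝ))) 1 = ∑ i, L (Pi.single i 1) := by
    simp only [ContinuousLinearMap.comp_apply]
    rw [dual_apply_pi]
    simp [commonShift]
  have h3 : ∀ i, ((L.comp (commonShift n (Real.sqrt (n - 2)))).comp
      (ContinuousLinearMap.inr ℝ ℝ (Fin n → ℝ))) (Pi.single i 1) =
        -(Real.sqrt (n - 2) * L (Pi.single i 1)) := by
    intro i
    simp only [ContinuousLinearMap.comp_apply]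
    rw [dual_apply_pi, Finset.sum_eq_single i (fun q _ hq => by simp [commonShift, hq]) (by simp)]
    simp [commonShift]
  simp_rw [h1, h2, h3, neg_sq, mul_pow, Real.sq_sqrt hn0]
  rw [sum_pairs_sq_add fun i => L (Pi.single i 1), ← Finset.mul_sum]
  push_cast
  ring

/-! ### Flip energies and reduction to independent normals -/

lemma spin_flip {n : ℕ} (σ : Config n) (i j : Fin n) :
    spin (flip σ i) j = (if j = i then -1 else 1) * spin σ j := by
  by_cases h : j = i
  · subst h; simp [spin, flip]
  · simp [spin, flip, h]

lemma hamiltonian_flip {n : ℕ} (W : Matrix (Fin n) (Fin n) ℝ) (σ : Config n) (i : Fin n) :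
    hamiltonian W (flip σ i) =
      hamiltonian W σ + 2 * localField σ (fun p => W p.1.1 p.1.2) i := by
  simp only [hamiltonian]
  rw [sum_sum_Ioi_eq_sum_subtype (fun i j => spin σ i * spin σ j * W i j),
    sum_sum_Ioi_eq_sum_subtype (fun k j => spin (flip σ i) k * spin (flip σ i) j * W k j)]
  simp only [localField, _root_.sum_apply, ContinuousLinearMap.smulRight_apply,
    ContinuousLinearMap.proj_apply, Finset.sum_apply, Finset.mul_sum, ← Finset.sum_add_distrib]
  refine Finset.sum_congr rfl fun p _ => ?_
  have hp := p.2.ne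
  rw [spin_flip, spin_flip]
  simp only [Pi.smul_apply, Pi.add_apply, Pi.single_apply, smul_eq_mul]
  by_cases h1 : p.1.1 = i
  · have h2 : p.1.2 ≠ i := fun h => hp (h1.trans h.symm)
    simp [h1, h2, Ne.symm h2]
    ring
  · by_cases h2 : p.1.2 = i
    · simp [h1, h2, Ne.symm h1]
      ring
    · simp [h1, h2, Ne.symm h1, Ne.symm h2]

lemma isLocallyOptimal_iff {n : ℕ} (W : Matrix (Fin n) (Fin n) ℝ) (σ : Config n) :
    IsLocallyOptimal W σ ↔ ∀ i, 0 ≤ localField σ (fun p => W p.1.1 p.1.2) i := by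
  refine forall_congr' fun i => ?_
  rw [hamiltonian_flip]
  constructor <;> intro h <;> linarith

/-- The probability of local optimality, in terms of `n + 1` independent standard normals. -/
lemma measureReal_isLocallyOptimal {n : ℕ} (hn : 2 ≤ n) {Ω : Type*} [MeasurableSpace Ω]
    {μ : Measure Ω} {W : Ω → Matrix (Fin n) (Fin n) ℝ} (hW : IsDisorder μ W) (σ : Config n) :
    μ.real {ω | IsLocallyOptimal (W ω) σ} =
      ((gaussianReal 0 1).prod (Measure.pi fun _ : Fin n => gaussianReal 0 1)).real
        {z | ∀ i, Real.sqrt (n - 2) * z.2 i ≤ z.1} := by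
  have hlaw := hW.indep.hasLaw_pi (μ := fun _ => gaussianReal 0 1)
    fun p : {p : Fin n × Fin n // p.1 < p.2} => hW.law p.1.1 p.1.2 p.2
  have hs : MeasurableSet {v : Fin n → ℝ | ∀ i, 0 ≤ v i} := by
    simp only [Set.ofPred_forall]
    exact MeasurableSet.iInter fun i => measurableSet_le measurable_const (measurable_pi_apply i)
  have hA := (localField σ).continuous.measurable
  simp only [isLocallyOptimal_iff]
  rw [hlaw.measureReal_eq (p := fun w => ∀ i, 0 ≤ localField σ w i) (hA hs)]
  have h := congrArg (fun ν => ν.real {v : Fin n → ℝ | ∀ i, 0 ≤ v i}) (map_localField hn σ)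
  rw [map_measureReal_apply hA hs,
    map_measureReal_apply (commonShift n _).continuous.measurable hs] at h
  refine h.trans (congrArg _ ?_)
  ext z
  simp [commonShift]

end SK
namespace SK

/-! ### Bounds for the standard normal distribution function -/

lemma one_sub_le_exp_neg_and_le {s : ℝ} (hs : 0 ≤ s) :
    1 - s ≤ Real.exp (-s) ∧ Real.exp (-s) ≤ 1 - s + s ^ 2 / 2 := by
  refine ⟨by linarith [Real.add_one_le_exp (-s)], ?_⟩
  -- The upper bound follows from (1 - s + s²/2)(1 + s + s²/2) = 1 + s⁴/4 ≥ 1.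
  have h := Real.quadratic_le_exp_of_nonneg hs
  have h1 : Real.exp (-s) * Real.exp s = 1 := by rw [← Real.exp_add]; simp
  have h2 : 0 ≤ 1 - s + s ^ 2 / 2 := by nlinarith [sq_nonneg (s - 1)]
  have h3 := mul_le_mul_of_nonneg_left h h2
  by_contra! hlt
  have h4 := mul_lt_mul_of_pos_right hlt (Real.exp_pos s)
  nlinarith [sq_nonneg (s ^ 2)]

lemma gaussianPDFReal_zero_one (x : ℝ) :
    gaussianPDFReal 0 1 x = (Real.sqrt (2 * Real.pi))⁻¹ * Real.exp (-(x ^ 2 / 2)) := by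
  simp [gaussianPDFReal, neg_div]

lemma continuous_gaussianPDFReal : Continuous (gaussianPDFReal 0 1) := by
  simp_rw [funext gaussianPDFReal_zero_one]
  fun_prop

lemma inv_sqrt_two_pi_bounds :
    0.3989 < (Real.sqrt (2 * Real.pi))⁻¹ ∧ (Real.sqrt (2 * Real.pi))⁻¹ < 0.39895 := by
  have h1 := Real.pi_gt_d4
  have h2 := Real.pi_lt_d4
  have hpos : 0 < Real.sqrt (2 * Real.pi) := Real.sqrt_pos.2 (by positivity)
  constructor
  · rw [lt_inv_comm₀ (by norm_num) hpos, Real.sqrt_lt' (by norm_num)]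
    norm_num
    linarith
  · rw [inv_lt_comm₀ hpos (by norm_num)]
    apply Real.lt_sqrt_of_sq_lt
    norm_num
    linarith

lemma measureReal_Ioc_gaussianReal {a b : ℝ} (hab : a ≤ b) :
    (gaussianReal 0 1).real (Set.Ioc a b) = ∫ x in a..b, gaussianPDFReal 0 1 x := by
  rw [measureReal_def, gaussianReal_apply_eq_integral _ one_ne_zero,
    intervalIntegral.integral_of_le hab, ENNReal.toReal_ofReal]
  exact integral_nonneg fun _ => gaussianPDFReal_nonneg _ _ _

lemma cdf_gaussianReal_sub {a b : ℝ} (hab : a ≤ b) :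
    cdf (gaussianReal 0 1) b - cdf (gaussianReal 0 1) a =
      ∫ x in a..b, gaussianPDFReal 0 1 x := by
  rw [← measureReal_Ioc_gaussianReal hab, cdf_eq_real, cdf_eq_real, ← Set.Iic_union_Ioc_eq_Iic hab,
    measureReal_union (Set.Iic_disjoint_Ioc le_rfl) measurableSet_Ioc]
  ring

lemma cdf_gaussianReal_neg (x : ℝ) :
    cdf (gaussianReal 0 1) (-x) = 1 - cdf (gaussianReal 0 1) x := by
  have := nullSingletonClass_gaussianReal (μ := 0) (v := 1) one_ne_zero
  rw [cdf_eq_real, cdf_eq_real, ← probReal_compl_eq_one_sub measurableSet_Iic, Set.compl_Iic]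
  have h : gaussianReal 0 1 = (gaussianReal 0 1).map (fun x => -x) := by
    rw [gaussianReal_map_neg, neg_zero]
  conv_lhs => rw [h]
  rw [map_measureReal_apply measurable_neg measurableSet_Iic,
    show (fun x : ℝ => -x) ⁻¹' Set.Iic (-x) = Set.Ici x by ext; simp]
  exact (measureReal_congr Ioi_ae_eq_Ici).symm

lemma cdf_gaussianReal_zero : cdf (gaussianReal 0 1) 0 = 1 / 2 := by
  have := cdf_gaussianReal_neg 0
  rw [neg_zero] at this
  linarith

lemma cdf_gaussianReal_sub_bounds {a b : ℝ} (ha : 0 ≤ a) (hab : a ≤ b) :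
    (Real.sqrt (2 * Real.pi))⁻¹ * Real.exp (-(b ^ 2 / 2)) * (b - a) ≤
        cdf (gaussianReal 0 1) b - cdf (gaussianReal 0 1) a ∧
      cdf (gaussianReal 0 1) b - cdf (gaussianReal 0 1) a ≤
        (Real.sqrt (2 * Real.pi))⁻¹ * Real.exp (-(a ^ 2 / 2)) * (b - a) := by
  rw [cdf_gaussianReal_sub hab]
  have hc : ∀ z : ℝ, (∫ _ in a..b, z) = z * (b - a) := fun z => by simp [mul_comm]
  rw [← hc, ← hc]
  have hi := continuous_gaussianPDFReal.intervalIntegrable (μ := volume) a b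
  constructor
  · refine intervalIntegral.integral_mono_on hab (by simp) hi fun x hx => ?_
    rw [gaussianPDFReal_zero_one]
    have h0 := ha.trans hx.1
    have h1 := hx.2
    gcongr
  · refine intervalIntegral.integral_mono_on hab hi (by simp) fun x hx => ?_
    rw [gaussianPDFReal_zero_one]
    have h0 := hx.1
    gcongr

lemma cdf_gaussianReal_taylor_bounds {u : ℝ} (hu : 0 ≤ u) :
    1 / 2 + (Real.sqrt (2 * Real.pi))⁻¹ * (u - u ^ 3 / 6) ≤ cdf (gaussianReal 0 1) u ∧
      cdf (gaussianReal 0 1) u ≤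
        1 / 2 + (Real.sqrt (2 * Real.pi))⁻¹ * (u - u ^ 3 / 6 + u ^ 5 / 40) := by
  have h := cdf_gaussianReal_sub hu
  rw [cdf_gaussianReal_zero] at h
  have hi := continuous_gaussianPDFReal.intervalIntegrable (μ := volume) 0 u
  have hlow : (∫ x in (0 : ℝ)..u, (Real.sqrt (2 * Real.pi))⁻¹ * (1 - x ^ 2 / 2)) =
      (Real.sqrt (2 * Real.pi))⁻¹ * (u - u ^ 3 / 6) := by
    rw [intervalIntegral.integral_const_mul, intervalIntegral.integral_sub
      (Continuous.intervalIntegrable (by fun_prop) _ _)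
      (Continuous.intervalIntegrable (by fun_prop) _ _),
      intervalIntegral.integral_div, integral_pow]
    congr 1
    norm_num
    ring
  have hup : (∫ x in (0 : ℝ)..u, (Real.sqrt (2 * Real.pi))⁻¹ * (1 - x ^ 2 / 2 + x ^ 4 / 8)) =
      (Real.sqrt (2 * Real.pi))⁻¹ * (u - u ^ 3 / 6 + u ^ 5 / 40) := by
    rw [intervalIntegral.integral_const_mul, intervalIntegral.integral_add
      (Continuous.intervalIntegrable (by fun_prop) _ _)
      (Continuous.intervalIntegrable (by fun_prop) _ _), intervalIntegral.integral_sub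
      (Continuous.intervalIntegrable (by fun_prop) _ _)
      (Continuous.intervalIntegrable (by fun_prop) _ _),
      intervalIntegral.integral_div, intervalIntegral.integral_div, integral_pow, integral_pow]
    congr 1
    norm_num
    ring
  have h1 : (∫ x in (0 : ℝ)..u, (Real.sqrt (2 * Real.pi))⁻¹ * (1 - x ^ 2 / 2)) ≤
      ∫ x in (0 : ℝ)..u, gaussianPDFReal 0 1 x := by
    refine intervalIntegral.integral_mono_on hu
      (Continuous.intervalIntegrable (by fun_prop) _ _) hi fun x _ => ?_
    rw [gaussianPDFReal_zero_one]
    gcongr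
    exact (one_sub_le_exp_neg_and_le (by positivity)).1
  have h2 : (∫ x in (0 : ℝ)..u, gaussianPDFReal 0 1 x) ≤
      ∫ x in (0 : ℝ)..u, (Real.sqrt (2 * Real.pi))⁻¹ * (1 - x ^ 2 / 2 + x ^ 4 / 8) := by
    refine intervalIntegral.integral_mono_on hu hi
      (Continuous.intervalIntegrable (by fun_prop) _ _) fun x _ => ?_
    rw [gaussianPDFReal_zero_one]
    gcongr
    refine (one_sub_le_exp_neg_and_le (by positivity)).2.trans_eq (by ring)
  constructor <;> linarith

lemma exp_le_two_mul_cdf_half : Real.exp 0.3 ≤ 2 * cdf (gaussianReal 0 1) (1 / 2) := by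
  have h1 := (cdf_gaussianReal_taylor_bounds (u := 1 / 2) (by norm_num)).1
  have h2 := inv_sqrt_two_pi_bounds.1
  -- Taking tenth powers turns this into a bound on e³.
  have h3 : Real.exp 0.3 ≤ 1.382 := by
    refine le_of_pow_le_pow_left₀ (n := 10) (by norm_num) (by norm_num) ?_
    rw [← Real.exp_nat_mul, show ((10 : ℕ) : ℝ) * 0.3 = (3 : ℕ) * 1 by norm_num, Real.exp_nat_mul]
    refine (pow_le_pow_left₀ (Real.exp_pos _).le Real.exp_one_lt_d9.le 3).trans ?_
    norm_num
  norm_num at h1 h2 h3 ⊢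
  linarith

/-- Φ is concave on the half-line, so it lies below its tangent at 1/2, near where Φ(y)e^(-y/2) is
largest. That line is compared with the quadratic Taylor polynomial of e^(y/2). -/
lemma two_mul_cdf_le_of_nonneg {y : ℝ} (hy : 0 ≤ y) :
    2 * cdf (gaussianReal 0 1) y ≤ 1.087 * Real.exp (y / 2) := by
  have hc := inv_sqrt_two_pi_bounds
  have hhalf := (cdf_gaussianReal_taylor_bounds (u := 1 / 2) (by norm_num)).2
  have he := one_sub_le_exp_neg_and_le (s := 1 / 8) (by norm_num)
  have htan : cdf (gaussianReal 0 1) y ≤ cdf (gaussianReal 0 1) (1 / 2) +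
      (Real.sqrt (2 * Real.pi))⁻¹ * Real.exp (-(1 / 8)) * (y - 1 / 2) := by
    rw [show (1 / 8 : ℝ) = (1 / 2) ^ 2 / 2 by norm_num]
    rcases le_total y (1 / 2) with h | h
    · linarith [(cdf_gaussianReal_sub_bounds hy h).1]
    · linarith [(cdf_gaussianReal_sub_bounds (by norm_num) h).2]
  have hexp := Real.quadratic_le_exp_of_nonneg (x := y / 2) (by positivity)
  generalize (Real.sqrt (2 * Real.pi))⁻¹ = c at *
  generalize Real.exp (-(1 / 8)) = e at *
  have hce : c * e * y ≤ 0.39895 * 0.8828125 * y := by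
    have : c * e ≤ 0.39895 * 0.8828125 :=
      mul_le_mul hc.2.le (by linarith [he.2]) (by linarith [he.1]) (by norm_num)
    gcongr
  have hce' : 0.3989 * 0.875 ≤ c * e :=
    mul_le_mul hc.1.le (by linarith [he.1]) (by norm_num) (by linarith)
  norm_num at *
  -- 0.592 is approximately the minimiser of the quadratic gap.
  nlinarith [sq_nonneg (y - 0.592)]

/-- Three ranges: a linear bound for u ≤ 1, monotonicity and the value at -1 for 1 ≤ u ≤ 2, and a
Chernoff bound for u ≥ 2. -/
lemma two_mul_cdf_le_of_nonpos {u : ℝ} (hu : 0 ≤ u) :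
    2 * cdf (gaussianReal 0 1) (-u) ≤ 1.087 * Real.exp (-u / 2) := by
  have hc := inv_sqrt_two_pi_bounds.1
  have he1 := Real.exp_neg_one_gt_d9
  rcases le_total u 1 with h1 | h1
  · rw [cdf_gaussianReal_neg]
    have h := (cdf_gaussianReal_sub_bounds le_rfl hu).1
    rw [cdf_gaussianReal_zero, sub_zero] at h
    have h3 : 0.6 ≤ Real.exp (-(u ^ 2 / 2)) := by
      have h4 : Real.exp (-(1 / 2)) ≤ Real.exp (-(u ^ 2 / 2)) := by
        gcongr
        exact pow_le_one₀ hu h1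
      have h5 : Real.exp (-1) = Real.exp (-(1 / 2)) ^ 2 := by
        rw [← Real.exp_nat_mul]
        norm_num
      have h6 := Real.exp_pos (-(1 / 2) : ℝ)
      nlinarith
    have h4 : 0.3989 * 0.6 * u ≤
        (Real.sqrt (2 * Real.pi))⁻¹ * Real.exp (-(u ^ 2 / 2)) * u := by
      gcongr
    have h5 := Real.add_one_le_exp (-u / 2)
    linarith
  rcases le_total u 2 with h2 | h2
  · have h := (cdf_gaussianReal_taylor_bounds zero_le_one).1
    have hm : cdf (gaussianReal 0 1) (-u) ≤ cdf (gaussianReal 0 1) (-1) :=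
      monotone_cdf _ (by linarith)
    rw [cdf_gaussianReal_neg 1] at hm
    have h3 : Real.exp (-1) ≤ Real.exp (-u / 2) := Real.exp_le_exp.2 (by linarith)
    linarith
  -- With t = -2 the Chernoff exponent is 2 - 2u, which is at most -1 - u/2 exactly when u ≥ 2.
  · have h := measure_le_le_exp_mul_mgf (μ := gaussianReal 0 1) (X := id) (t := -2) (-u)
      (by norm_num) (integrable_exp_mul_gaussianReal _)
    rw [mgf_id_gaussianReal, ← Real.exp_add] at h
    rw [cdf_eq_real]
    have h3 : Real.exp (-(-2) * -u + (0 * -2 + ((1 : NNReal) : ℝ) * (-2) ^ 2 / 2)) ≤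
        Real.exp (-1) * Real.exp (-u / 2) := by
      rw [← Real.exp_add]
      apply Real.exp_le_exp.2
      norm_num
      linarith
    have h4 : Real.exp (-1) * Real.exp (-u / 2) ≤ 0.5 * Real.exp (-u / 2) := by
      gcongr
      exact Real.exp_neg_one_lt_d9.le.trans (by norm_num)
    have h5 := Real.exp_pos (-u / 2)
    have h6 : (gaussianReal 0 1).real (Set.Iic (-u)) ≤ 0.5 * Real.exp (-u / 2) :=
      h.trans (h3.trans h4)
    norm_num at h6 ⊢
    linarith

lemma two_mul_cdf_le (y : ℝ) :
    2 * cdf (gaussianReal 0 1) y ≤ 1.087 * Real.exp (y / 2) := by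
  rcases le_total 0 y with h | h
  · exact two_mul_cdf_le_of_nonneg h
  · simpa using two_mul_cdf_le_of_nonpos (neg_nonneg.2 h)

end SK
namespace SK

/-! ### Bounds for the probability of local optimality -/

/-- `P(c Y_i ≤ X for all i)` for `n + 1` independent standard normals `X, Y_1, …, Y_n`. -/
noncomputable def orthantProb (n : ℕ) (c : ℝ) : ℝ :=
  ((gaussianReal 0 1).prod (Measure.pi fun _ : Fin n => gaussianReal 0 1)).real
    {z | ∀ i, c * z.2 i ≤ z.1}

lemma orthantProb_le_one (n : ℕ) (c : ℝ) : orthantProb n c ≤ 1 := measureReal_le_one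

lemma mul_cdf_pow_le_orthantProb (n : ℕ) {c x y : ℝ} (hc : 0 ≤ c) (s : Set ℝ)
    (hs : ∀ z ∈ s, x ≤ z) (hxy : c * y ≤ x) :
    (gaussianReal 0 1).real s * cdf (gaussianReal 0 1) y ^ n ≤ orthantProb n c := by
  have h : (gaussianReal 0 1).real s * cdf (gaussianReal 0 1) y ^ n =
      ((gaussianReal 0 1).prod (Measure.pi fun _ : Fin n => gaussianReal 0 1)).real
        (s ×ˢ Set.univ.pi fun _ => Set.Iic y) := by
    rw [measureReal_prod_prod, measureReal_def (Measure.pi _), Measure.pi_pi]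
    simp [cdf_eq_real, measureReal_def]
  rw [h]
  refine measureReal_mono fun z hz i => ?_
  have h1 : z.2 i ≤ y := hz.2 i (Set.mem_univ i)
  exact (mul_le_mul_of_nonneg_left h1 hc).trans (hxy.trans (hs _ hz.1))

/-- The event X > 0, all Y_i ≤ 0 suffices. The bound serves only to give positivity, including at c
= 0. -/
lemma two_inv_pow_le_orthantProb (n : ℕ) {c : ℝ} (hc : 0 ≤ c) :
    (1 / 2) ^ (n + 1) ≤ orthantProb n c := by
  have h := mul_cdf_pow_le_orthantProb n (x := 0) (y := 0) hc (Set.Ioi 0)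
    (fun z hz => le_of_lt hz) (by simp)
  have h1 : (gaussianReal 0 1).real (Set.Ioi 0) = 1 / 2 := by
    rw [← Set.compl_Iic, probReal_compl_eq_one_sub measurableSet_Iic, ← cdf_eq_real,
      cdf_gaussianReal_zero]
    norm_num
  rwa [h1, cdf_gaussianReal_zero, ← pow_succ'] at h

lemma orthantProb_lower (n : ℕ) {c : ℝ} (hc : 0 ≤ c) :
    0.3989 * Real.exp (-((c / 2 + 1) ^ 2 / 2)) * (Real.exp 0.3 / 2) ^ n ≤ orthantProb n c := by
  refine le_trans ?_ (mul_cdf_pow_le_orthantProb n (x := c / 2) (y := 1 / 2) hc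
    (Set.Ioc (c / 2) (c / 2 + 1)) (fun z hz => hz.1.le) (by linarith))
  rw [measureReal_Ioc_gaussianReal (by linarith), ← cdf_gaussianReal_sub (by linarith)]
  have h := (cdf_gaussianReal_sub_bounds (a := c / 2) (b := c / 2 + 1)
    (by positivity) (by linarith)).1
  rw [add_sub_cancel_left, mul_one] at h
  have h1 : 0.3989 * Real.exp (-((c / 2 + 1) ^ 2 / 2)) ≤
      cdf (gaussianReal 0 1) (c / 2 + 1) - cdf (gaussianReal 0 1) (c / 2) := by
    refine le_trans ?_ h
    gcongr
    exact inv_sqrt_two_pi_bounds.1.le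
  have h2 : Real.exp 0.3 / 2 ≤ cdf (gaussianReal 0 1) (1 / 2) := by
    linarith [exp_le_two_mul_cdf_half]
  refine mul_le_mul h1 (pow_le_pow_left₀ (by positivity) h2 n) (by positivity)
    (le_trans (by positivity) h1)

lemma orthantProb_eq_integral (n : ℕ) {c : ℝ} (hc : 0 < c) :
    orthantProb n c = ∫ x, cdf (gaussianReal 0 1) (x / c) ^ n ∂gaussianReal 0 1 := by
  have hs : MeasurableSet {z : ℝ × (Fin n → ℝ) | ∀ i, c * z.2 i ≤ z.1} := by
    simp only [Set.ofPred_forall]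
    exact MeasurableSet.iInter fun i => measurableSet_le (by fun_prop) (by fun_prop)
  have hm : Measurable fun x => cdf (gaussianReal 0 1) (x / c) ^ n :=
    ((monotone_cdf _).measurable.comp (measurable_id.div_const c)).pow_const n
  rw [orthantProb, measureReal_def, Measure.prod_apply hs,
    integral_eq_lintegral_of_nonneg_ae (ae_of_all _ fun x => pow_nonneg (cdf_nonneg _ _) n)
      hm.aestronglyMeasurable]
  congr 1
  refine lintegral_congr fun x => ?_
  have hx : Prod.mk x ⁻¹' {z : ℝ × (Fin n → ℝ) | ∀ i, c * z.2 i ≤ z.1} =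
      Set.univ.pi fun _ => Set.Iic (x / c) := by
    ext y
    simp [Pi.le_def, le_div_iff₀ hc, mul_comm c]
  rw [hx, Measure.pi_pi, ENNReal.ofReal_pow (cdf_nonneg _ _), ofReal_cdf]
  simp

lemma orthantProb_upper (n : ℕ) {c : ℝ} (hc : 0 < c) :
    orthantProb n c ≤ (1.087 / 2) ^ n * Real.exp (n ^ 2 / (8 * c ^ 2)) := by
  have hmgf := congrFun (mgf_id_gaussianReal (μ := 0) (v := 1)) (n / (2 * c))
  rw [mgf] at hmgf
  have hval : (1.087 / 2) ^ n * Real.exp (n ^ 2 / (8 * c ^ 2)) =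
      ∫ x, (1.087 / 2) ^ n * Real.exp (n / (2 * c) * x) ∂gaussianReal 0 1 := by
    rw [integral_const_mul]
    refine congrArg _ (Eq.trans ?_ hmgf.symm)
    congr 1
    simp
    field_simp
    norm_num
  rw [orthantProb_eq_integral n hc, hval]
  refine integral_mono_of_nonneg (ae_of_all _ fun x => pow_nonneg (cdf_nonneg _ _) n)
    ((integrable_exp_mul_gaussianReal _).const_mul _) (ae_of_all _ fun x => ?_)
  have h : cdf (gaussianReal 0 1) (x / c) ≤ 1.087 / 2 * Real.exp (x / c / 2) := by
    linarith [two_mul_cdf_le (x / c)]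
  refine (pow_le_pow_left₀ (cdf_nonneg _ _) h n).trans_eq ?_
  rw [mul_pow, ← Real.exp_nat_mul]
  congr 2
  field_simp

lemma log_orthantProb_bounds {n : ℕ} (hn : 2 ≤ n) :
    n * (1 / (2 * Real.pi) - Real.log 2) - 20 ≤ Real.log (orthantProb n (Real.sqrt (n - 2))) ∧
      Real.log (orthantProb n (Real.sqrt (n - 2))) ≤
        n * (2 / (3 * Real.pi) - Real.log 2) + 20 := by
  have hpi1 := Real.pi_gt_d4
  have hpi2 := Real.pi_lt_d4
  have hl2 := Real.log_two_lt_d9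
  have hl2' := Real.log_pos one_lt_two
  have hn2 : (2 : ℝ) ≤ n := by exact_mod_cast hn
  have hpos : 0 < orthantProb n (Real.sqrt (n - 2)) :=
    lt_of_lt_of_le (by positivity) (two_inv_pow_le_orthantProb n (Real.sqrt_nonneg _))
  constructor
  · have h := Real.log_le_log (by positivity)
      (orthantProb_lower n (Real.sqrt_nonneg ((n : ℝ) - 2)))
    rw [Real.log_mul (by positivity) (by positivity), Real.log_mul (by norm_num) (by positivity),
      Real.log_exp, Real.log_pow, Real.log_div (by positivity) (by norm_num), Real.log_exp] at h
    have hc : -2 ≤ Real.log 0.3989 := by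
      rw [Real.le_log_iff_exp_le (by norm_num)]
      have h1 := Real.exp_neg_one_lt_d9
      have h2 : Real.exp (-2) ≤ Real.exp (-1) := Real.exp_le_exp.2 (by norm_num)
      linarith
    have hp : 1 / (2 * Real.pi) ≤ 0.16 := by
      rw [div_le_iff₀ (by positivity)]
      linarith
    have hsq := Real.sq_sqrt (show (0 : ℝ) ≤ n - 2 by linarith)
    have hn' : (n : ℝ) = Real.sqrt (n - 2) ^ 2 + 2 := by linarith
    have hp' := mul_le_mul_of_nonneg_left hp (show (0 : ℝ) ≤ n by linarith)
    -- Expanding (c/2 + 1)²/2 leaves a term c/2 of order √n; the slack 0.3 - 1/8 - 0.16 per site,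
    -- together with the constant 20, absorbs it.
    nlinarith [sq_nonneg (Real.sqrt (n - 2) - 20)]
  -- At n = 2 the coefficient c vanishes and `orthantProb_upper` does not apply; there the trivial
  -- bound by 1 is enough.
  · rcases hn.eq_or_lt with rfl | hn3
    · have h1 := Real.log_nonpos hpos.le (orthantProb_le_one 2 _)
      have h2 : 0 < 2 / (3 * Real.pi) := by positivity
      refine h1.trans ?_
      push_cast
      linarith
    have hn3' : (3 : ℝ) ≤ n := by exact_mod_cast hn3
    have hcpos : 0 < Real.sqrt ((n : ℝ) - 2) := Real.sqrt_pos.2 (by linarith)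
    have h := Real.log_le_log hpos (orthantProb_upper n hcpos)
    rw [Real.log_mul (by positivity) (by positivity), Real.log_exp, Real.log_pow,
      Real.log_div (by norm_num) (by norm_num), Real.sq_sqrt (by linarith)] at h
    have hK : Real.log 1.087 ≤ 0.087 :=
      (Real.log_le_sub_one_of_pos (by norm_num)).trans (by norm_num)
    have hp : 0.212 ≤ 2 / (3 * Real.pi) := by
      rw [le_div_iff₀ (by positivity)]
      linarith
    -- Equivalent to n² ≤ (n + 6)(n - 2) = n² + 4n - 12, that is, n ≥ 3.
    have hq : (n : ℝ) ^ 2 / (8 * (n - 2)) ≤ (n + 6) / 8 := by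
      rw [div_le_div_iff₀ (by linarith) (by norm_num)]
      nlinarith
    have hp' := mul_le_mul_of_nonneg_left hp (show (0 : ℝ) ≤ n by linarith)
    have hK' := mul_le_mul_of_nonneg_left hK (show (0 : ℝ) ≤ n by linarith)
    linarith

/-! ### The one-spin case and the conclusion -/

lemma isLocallyOptimal_of_one (W : Matrix (Fin 1) (Fin 1) ℝ) (σ : Config 1) :
    IsLocallyOptimal W σ := by
  intro i
  have h : ∀ τ : Config 1, hamiltonian W τ = 0 := fun τ => by
    refine Finset.sum_eq_zero fun j _ => Finset.sum_eq_zero fun k hk => ?_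
    exact absurd (Finset.mem_Ioi.1 hk) (by simp [Subsingleton.elim j k])
  rw [h, h]

end SK

theorem mainTheorem2 :
    ∃ C : ℝ, ∀ (n : ℕ), 1 ≤ n →
      ∀ (Ω : Type*) [MeasurableSpace Ω] (μ : Measure Ω) [IsProbabilityMeasure μ]
        (W : Ω → Matrix (Fin n) (Fin n) ℝ), SK.IsDisorder μ W →
      ∀ σ : SK.Config n,
        0 < μ.real {ω | SK.IsLocallyOptimal (W ω) σ} ∧
        1 / (2 * Real.pi) - Real.log 2 - C / (n : ℝ) ≤
          1 / (n : ℝ) * Real.log (μ.real {ω | SK.IsLocallyOptimal (W ω) σ}) ∧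
        1 / (n : ℝ) * Real.log (μ.real {ω | SK.IsLocallyOptimal (W ω) σ}) ≤
          2 / (3 * Real.pi) - Real.log 2 + C / (n : ℝ) := by
  refine ⟨20, fun n hn Ω _ μ _ W hW σ => ?_⟩
  have hn0 : (0 : ℝ) < n := by exact_mod_cast hn
  have key : 0 < μ.real {ω | SK.IsLocallyOptimal (W ω) σ} ∧
      n * (1 / (2 * Real.pi) - Real.log 2) - 20 ≤
        Real.log (μ.real {ω | SK.IsLocallyOptimal (W ω) σ}) ∧
      Real.log (μ.real {ω | SK.IsLocallyOptimal (W ω) σ}) ≤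
        n * (2 / (3 * Real.pi) - Real.log 2) + 20 := by
    -- For n = 1 there are no couplings and the probability is 1; the representation with √(n - 2)
    -- needs n ≥ 2.
    rcases hn.eq_or_lt with rfl | hn2
    · have hp : 1 / (2 * Real.pi) ≤ 1 := by
        rw [div_le_one (by positivity)]
        linarith [Real.pi_gt_three]
      have hp' : 0 < 2 / (3 * Real.pi) := by positivity
      have hl := Real.log_two_lt_d9
      have hl' := Real.log_pos one_lt_two
      simp only [SK.isLocallyOptimal_of_one, Set.ofPred_true, probReal_univ, Real.log_one]
      refine ⟨one_pos, ?_, ?_⟩ <;> push_cast <;> linarith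
    · rw [SK.measureReal_isLocallyOptimal hn2 hW]
      exact ⟨lt_of_lt_of_le (by positivity)
        (SK.two_inv_pow_le_orthantProb n (Real.sqrt_nonneg _)), SK.log_orthantProb_bounds hn2⟩
  refine ⟨key.1, ?_, ?_⟩
  · rw [one_div_mul_eq_div, le_div_iff₀ hn0, sub_mul, div_mul_cancel₀ _ hn0.ne']
    linarith [key.2.1]
  · rw [one_div_mul_eq_div, div_le_iff₀ hn0, add_mul, div_mul_cancel₀ _ hn0.ne']
    linarith [key.2.2]
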